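/- **Setting.** Let $\mathcal X$ be a measurable space and let $\mathcal X^{n\times k}$ be the space of $n\times k$ databases with the product $\sigma$-algebra. A structured Pufferfish framework $(\mathcal G,\mathcal W,\mathcal E,\Theta)$ consists of finite families $\mathcal G$ and $\mathcal W$ of measurable functions on $\mathcal X^{n\times k}$ (the private and the public functions; the values of the private functions lie in standard Borel spaces), the edge set $\mathcal E$ of a bipartite graph between $\mathcal G$ and $\mathcal W$ (we write $g\sim w$ for an edge), and a set $\Theta$ of probability measures on $\mathcal X^{n\times k}$. Put $\mathcal W^\star=\{w\in\mathcal W:\ \exists g\in\mathcal G,\ g\sim w\}$. A randomized mechanism $M$ (a Markov kernel $P_{M|X}$) is $\epsilon$-MI PP in this framework if $$\sup_{P_X\in\Theta,\ g\sim w}\mathsf I\big(g(X);M(X)\,\big|\,w(X)\big)\le\epsilon ,$$ where $X\sim P_X$ and $\mathsf I(U;V|W)=\int \mathsf D_{\mathsf{KL}}\big(P_{UV|W=c}\,\big\|\,P_{U|W=c}\otimes P_{V|W=c}\big)\,dP_W(c)$ is conditional mutual information in nats. **Theorem (Gaussian mechanism with projections).** Fix $\epsilon>0$, a structured Pufferfish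 framework $(\mathcal G,\mathcal W,\mathcal E,\Theta)$, integers $1\le\ell\le d$, $\sigma\in\mathbb R$, and a measurable query $f:\mathcal X^{n\times k}\to\mathbb R^d$ such that, for all $P_X\in\Theta$ and $w\in\mathcal W^\star$, $\mathbb E[\|f(X)\|^2\,|\,w(X)]<\infty$ almost surely. Let $\mu_{f|w}$ and $\Sigma_{f|w}$ be the mean vector and the covariance matrix of the regular conditional distribution of $f(X)$ given $w(X)$, let $\|\cdot\|$ be the Euclidean norm and $\|\cdot\|_{\mathrm{op}}$ the operator norm. For a matrix $\mathrm A\in\mathbb R^{d\times\ell}$ consider the mechanism $M(X)=\mathrm A^{\intercal}f(X)+Z$, where $Z\sim\mathcal N(0,\sigma^2\mathrm I_\ell)$ is independent of $X$. Then $M$ is $\epsilon$-MI PP in each of the following two cases (expectations and suprema take values in $[0,\infty]$): 1. $\mathrm A=[\phi_1,\dots,\phi_\ell]$ is deterministic and $$\sigma^2\ \ge\ \sup_{P_X\in\Theta,\ w\in\mathcal W^\star}\frac{\mathbb E\big[\|\Sigma_{f|w}\|_{\mathrm{op}}\big]\,\max_{1\le j\le\ell}\|\phi_j\|^2}{e^{2\epsilon/\ell}-1}.$$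 2. $\mathrm A=[\Phi_1,\dots,\Phi_\ell]$ is random, $\mathrm A$, $X$ and $Z$ are mutually independent, $\mathbb E[\|\Phi_j\|^2]=1$ and $\mathbb E[\Phi_j]=0$ for all $j=1,\dots,\ell$, and $$\sigma^2\ \ge\ \sup_{P_X\in\Theta,\ w\in\mathcal W^\star}\frac{\mathbb E\big[\|\Sigma_{f|w}\|_{\mathrm{op}}+\|\mu_{f|w}\|^2\big]}{e^{2\epsilon/\ell}-1}.$$ -/

import Mathlib

open MeasureTheory ProbabilityTheory InformationTheory
open scoped ENNReal

noncomputable section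

namespace PufferfishMI

/-- Matrices carry the product σ-algebra of their entries. -/
instance matrixMeasurableSpace {m n R : Type*} [MeasurableSpace R] :
    MeasurableSpace (Matrix m n R) :=
  inferInstanceAs (MeasurableSpace (m → n → R))

/-- The space of `n × k` databases with entries in `𝒳`. -/
abbrev Database (𝒳 : Type*) (n k : ℕ) : Type _ := Matrix (Fin n) (Fin k) 𝒳

/-- Mutual information `I(U;V) = D_KL(P_{UV} ‖ P_U ⊗ P_V)` of a pair with joint law `ρ = P_{UV}`,
in nats. -/
def mutualInfo {S Y : Type*} [MeasurableSpace S] [MeasurableSpace Y] (ρ : Measure (S × Y)) :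
    ℝ≥0∞ :=
  klDiv ρ (ρ.fst.prod ρ.snd)

/-- Conditional mutual information `I(U;V|W) = ∫ I(U;V|W=c) dP_W(c)`, where `I(U;V|W=c)` is the
mutual information of the regular conditional law of `(U,V)` given `W = c`. -/
def condMutualInfo {Ω S Y T : Type*} [MeasurableSpace Ω] [MeasurableSpace T]
    [MeasurableSpace S] [StandardBorelSpace S] [Nonempty S]
    [MeasurableSpace Y] [StandardBorelSpace Y] [Nonempty Y]
    (U : Ω → S) (V : Ω → Y) (W : Ω → T) (μ : Measure Ω) [IsFiniteMeasure μ] : ℝ≥0∞ :=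
  ∫⁻ c, mutualInfo (condDistrib (fun ω => (U ω, V ω)) W μ c) ∂(μ.map W)

/-- The mechanism `K` (a Markov kernel `P_{M|X}`) is `ε`-MI PP in the framework with private
functions `g i`, public functions `w j`, edge relation `E` and data distributions `Θ`. Under
`P ⊗ₘ K` the first coordinate is the database `X ∼ P` and the second one is `M(X)`. -/
def IsMIPP {D Y ι κ : Type*} [MeasurableSpace D]
    [MeasurableSpace Y] [StandardBorelSpace Y] [Nonempty Y]
    {S : ι → Type*} [∀ i, MeasurableSpace (S i)] [∀ i, StandardBorelSpace (S i)]
    [∀ i, Nonempty (S i)] {T : κ → Type*} [∀ j, MeasurableSpace (T j)]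
    (g : ∀ i, D → S i) (w : ∀ j, D → T j) (E : ι → κ → Prop) (Θ : Set (ProbabilityMeasure D))
    (ε : ℝ) (K : Kernel D Y) [IsMarkovKernel K] : Prop :=
  ⨆ P ∈ Θ, ⨆ i, ⨆ j, ⨆ _ : E i j,
    condMutualInfo (fun p : D × Y => g i p.1) (fun p : D × Y => p.2) (fun p : D × Y => w j p.1)
      ((P : Measure D) ⊗ₘ K) ≤ ENNReal.ofReal ε

/-- The set `𝒲⋆` of (indices of) public functions that are joined to some private function. -/
def activePublic {ι κ : Type*} (E : ι → κ → Prop) : Set κ := {j | ∃ i, E i j}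

/-- The `j`-th column of `A`, as a vector of Euclidean space. -/
def column {d ℓ : ℕ} (A : Matrix (Fin d) (Fin ℓ) ℝ) (j : Fin ℓ) : EuclideanSpace ℝ (Fin d) :=
  WithLp.toLp 2 (A.col j)

/-- The Gaussian law `N(0, σ² I_ℓ)`. -/
def isotropicGaussian (ℓ : ℕ) (σ : ℝ) : Measure (EuclideanSpace ℝ (Fin ℓ)) :=
  multivariateGaussian 0 (σ ^ 2 • (1 : Matrix (Fin ℓ) (Fin ℓ) ℝ))

instance (ℓ : ℕ) (σ : ℝ) : IsProbabilityMeasure (isotropicGaussian ℓ σ) := by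
  unfold isotropicGaussian; infer_instance

/-- The map `(x, (A, z)) ↦ Aᵀ f(x) + z`. -/
def projectedOutput {D : Type*} {d ℓ : ℕ} (f : D → EuclideanSpace ℝ (Fin d))
    (p : D × (Matrix (Fin d) (Fin ℓ) ℝ × EuclideanSpace ℝ (Fin ℓ))) : EuclideanSpace ℝ (Fin ℓ) :=
  WithLp.toLp 2 (p.2.1.transpose.mulVec (f p.1).ofLp) + p.2.2

lemma measurable_projectedOutput {D : Type*} [MeasurableSpace D] {d ℓ : ℕ}
    {f : D → EuclideanSpace ℝ (Fin d)} (hf : Measurable f) :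
    Measurable (projectedOutput (ℓ := ℓ) f) := by
  unfold projectedOutput
  refine Measurable.add ?_ (by fun_prop)
  refine (WithLp.measurable_toLp 2 _).comp (measurable_pi_lambda _ fun j => ?_)
  simp only [Matrix.mulVec, dotProduct, Matrix.transpose_apply]
  refine Finset.measurable_sum _ fun i _ => Measurable.mul ?_ ?_
  · have h : Measurable (fun A : Matrix (Fin d) (Fin ℓ) ℝ => A i j) :=
      (measurable_pi_apply j).comp (measurable_pi_apply i)
    exact h.comp (by fun_prop)
  · fun_prop

/-- The mechanism `M(X) = Aᵀ f(X) + Z` as a Markov kernel: given the database, the matrix `A ∼ ν`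
and the noise `Z ∼ N(0, σ² I_ℓ)` are drawn independently (of each other and of the database).
A deterministic matrix `A` is the case `ν = dirac A`. -/
def projectedGaussianMechanism {D : Type*} [MeasurableSpace D] {d ℓ : ℕ}
    (f : D → EuclideanSpace ℝ (Fin d)) (_hf : Measurable f)
    (ν : Measure (Matrix (Fin d) (Fin ℓ) ℝ)) (σ : ℝ) : Kernel D (EuclideanSpace ℝ (Fin ℓ)) :=
  (Kernel.id ×ₖ Kernel.const D (ν.prod (isotropicGaussian ℓ σ))).map (projectedOutput f)

instance {D : Type*} [MeasurableSpace D] {d ℓ : ℕ} (f : D → EuclideanSpace ℝ (Fin d))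
    (hf : Measurable f) (ν : Measure (Matrix (Fin d) (Fin ℓ) ℝ)) [IsProbabilityMeasure ν] (σ : ℝ) :
    IsMarkovKernel (projectedGaussianMechanism f hf ν σ) := by
  unfold projectedGaussianMechanism
  exact Kernel.IsMarkovKernel.map _ (measurable_projectedOutput hf)

/-- Mean vector of a law on `ℝ^d`. -/
def meanVector {d : ℕ} (ρ : Measure (EuclideanSpace ℝ (Fin d))) : EuclideanSpace ℝ (Fin d) :=
  ∫ y, y ∂ρ

/-- Covariance matrix of a law on `ℝ^d`. -/
def covarianceMatrix {d : ℕ} (ρ : Measure (EuclideanSpace ℝ (Fin d))) :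
    Matrix (Fin d) (Fin d) ℝ :=
  Matrix.of fun i j => cov[fun y => y i, fun y => y j; ρ]

/-- Operator norm of a matrix with respect to Euclidean norms. -/
def opENorm {d : ℕ} (B : Matrix (Fin d) (Fin d) ℝ) : ℝ≥0∞ :=
  ‖Matrix.toEuclideanCLM (n := Fin d) (𝕜 := ℝ) B‖ₑ

section Conditional

variable {D T : Type*} [MeasurableSpace D] [MeasurableSpace T] {d : ℕ}

/-- `μ_{f|w}` at the value `w(X) = c`: the mean of the regular conditional law of `f(X)`. -/
def condMean (P : Measure D) [IsFiniteMeasure P] (f : D → EuclideanSpace ℝ (Fin d)) (w : D → T)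
    (c : T) : EuclideanSpace ℝ (Fin d) :=
  meanVector (condDistrib f w P c)

/-- `Σ_{f|w}` at the value `w(X) = c`: the covariance matrix of the regular conditional law of
`f(X)`. -/
def condCovariance (P : Measure D) [IsFiniteMeasure P] (f : D → EuclideanSpace ℝ (Fin d))
    (w : D → T) (c : T) : Matrix (Fin d) (Fin d) ℝ :=
  covarianceMatrix (condDistrib f w P c)

/-- Given `w(X)`, the query `f(X)` almost surely has finite conditional second moment, so that the
conditional mean and covariance exist. -/
def HasCondSecondMoment (P : Measure D) [IsFiniteMeasure P] (f : D → EuclideanSpace ℝ (Fin d))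
    (w : D → T) : Prop :=
  ∀ᵐ x ∂P, MemLp id 2 (condDistrib f w P (w x))

end Conditional

end PufferfishMI

end

open PufferfishMI

/-!
Conditional mutual information is dominated by the divergence from any reference law of the output
that depends on the public value only: `I(g(X); M | w(X)) ≤ ∫ D(K(x) ‖ Q(w(x))) dP(x)` for every
Markov kernel `Q`, by the chain rule and data processing. For the Gaussian channel take
`Q(c) = N(m(c), σ² e^{2ε/ℓ} I_ℓ)`. Since the variance of `Q` is fixed in advance, the divergence is
affine in `‖Aᵀ f(x) - m(w(x))‖²`, and no concavity argument is needed: the bound equals `ε` exactly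
when the mean squared deviation equals `ℓ σ² (e^{2ε/ℓ} - 1)`. For deterministic `A` the centre
`m = Aᵀ μ_{f|w}` makes the deviation a sum of conditional variances in the directions `φ_j`; for
random `A` the centre `m = 0` suffices, the second moment being the covariance part plus
`‖μ_{f|w}‖²`.
-/

namespace PufferfishMI

section KullbackLeibler

variable {α β : Type*} {mα : MeasurableSpace α} {mβ : MeasurableSpace β}

lemma klDiv_compProd_of_ae_absolutelyContinuous
    [MeasurableSpace.CountableOrCountablyGenerated α β] {μ : Measure α} [IsFiniteMeasure μ]
    {κ η : Kernel α β} [IsFiniteKernel κ] [IsFiniteKernel η] (h : ∀ᵐ a ∂μ, κ a ≪ η a) :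
    klDiv (μ ⊗ₘ κ) (μ ⊗ₘ η) = ∫⁻ a, klDiv (κ a) (η a) ∂μ := by
  have hdens : μ ⊗ₘ κ = (μ ⊗ₘ η).withDensity fun p => κ.rnDeriv η p.1 p.2 := by
    have hκ : κ =ᵐ[μ] η.withDensity (κ.rnDeriv η) := by
      filter_upwards [h] with a ha using (Kernel.withDensity_rnDeriv_eq ha).symm
    rw [Measure.compProd_congr hκ, Measure.compProd_withDensity (κ.measurable_rnDeriv η)]
  have hrn : (μ ⊗ₘ κ).rnDeriv (μ ⊗ₘ η) =ᵐ[μ ⊗ₘ η] fun p => κ.rnDeriv η p.1 p.2 := by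
    rw [hdens]
    exact Measure.rnDeriv_withDensity _ (κ.measurable_rnDeriv η)
  calc klDiv (μ ⊗ₘ κ) (μ ⊗ₘ η)
      = ∫⁻ p, ENNReal.ofReal (klFun (κ.rnDeriv η p.1 p.2).toReal) ∂(μ ⊗ₘ η) := by
        rw [klDiv_eq_lintegral_klFun_of_ac (Measure.absolutelyContinuous_compProd_right_iff.2 h)]
        refine lintegral_congr_ae ?_
        filter_upwards [hrn] with p hp using by rw [hp]
    _ = ∫⁻ a, ∫⁻ b, ENNReal.ofReal (klFun (κ.rnDeriv η a b).toReal) ∂(η a) ∂μ :=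
        Measure.lintegral_compProd (by fun_prop)
    _ = ∫⁻ a, klDiv (κ a) (η a) ∂μ := by
        refine lintegral_congr_ae ?_
        filter_upwards [h] with a ha
        rw [klDiv_eq_lintegral_klFun_of_ac ha]
        refine lintegral_congr_ae ?_
        filter_upwards [Kernel.rnDeriv_eq_rnDeriv_measure (κ := κ) (η := η) (a := a)] with b hb
        rw [hb]

theorem klDiv_compProd_eq_lintegral [MeasurableSpace.CountableOrCountablyGenerated α β]
    (μ : Measure α) [IsFiniteMeasure μ] (κ η : Kernel α β) [IsFiniteKernel κ] [IsFiniteKernel η] :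
    klDiv (μ ⊗ₘ κ) (μ ⊗ₘ η) = ∫⁻ a, klDiv (κ a) (η a) ∂μ := by
  by_cases h : ∀ᵐ a ∂μ, κ a ≪ η a
  · exact klDiv_compProd_of_ae_absolutelyContinuous h
  rw [klDiv_of_not_ac (mt Measure.absolutelyContinuous_compProd_right_iff.1 h)]
  have htop : {a | κ a ≪ η a}ᶜ ⊆ {a | klDiv (κ a) (η a) = ∞} := fun a ha => klDiv_of_not_ac ha
  refine (top_unique ?_).symm
  calc ∞ = ∫⁻ _ in {a | κ a ≪ η a}ᶜ, ∞ ∂μ := by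
        rw [setLIntegral_const, ENNReal.top_mul]; exact mt ae_iff.2 h
    _ = ∫⁻ a in {a | κ a ≪ η a}ᶜ, klDiv (κ a) (η a) ∂μ :=
        (setLIntegral_congr_fun (Kernel.measurableSet_absolutelyContinuous κ η).compl htop).symm
    _ ≤ ∫⁻ a, klDiv (κ a) (η a) ∂μ := setLIntegral_le_lintegral _ _

lemma klDiv_comp_le_lintegral [MeasurableSpace.CountableOrCountablyGenerated α β]
    (μ : Measure α) [IsProbabilityMeasure μ] (κ : Kernel α β) [IsFiniteKernel κ]
    (Q : Measure β) [IsFiniteMeasure Q] :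
    klDiv (κ ∘ₘ μ) Q ≤ ∫⁻ a, klDiv (κ a) Q ∂μ := by
  calc klDiv (κ ∘ₘ μ) Q = klDiv (μ ⊗ₘ κ).snd (μ ⊗ₘ Kernel.const α Q).snd := by
        rw [Measure.snd_compProd, Measure.snd_compProd, Measure.const_comp, measure_univ, one_smul]
    _ ≤ klDiv (μ ⊗ₘ κ) (μ ⊗ₘ Kernel.const α Q) := klDiv_map_le _ _ measurable_snd
    _ = ∫⁻ a, klDiv (κ a) Q ∂μ := klDiv_compProd_eq_lintegral μ κ (Kernel.const α Q)

lemma mutualInfo_le_klDiv_prod [StandardBorelSpace α] [Nonempty α]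
    (ρ : Measure (α × β)) [IsProbabilityMeasure ρ] (Q : Measure β) [IsProbabilityMeasure Q] :
    mutualInfo ρ ≤ klDiv ρ (ρ.fst.prod Q) := by
  set ρ' : Measure (β × α) := ρ.map Prod.swap with hρ'
  have hdis : ρ.snd ⊗ₘ ρ'.condKernel = ρ' := by
    rw [← Measure.fst_map_swap, ← hρ', Measure.disintegrate]
  have hback : ρ'.map Prod.swap = ρ := by
    rw [hρ', Measure.map_map measurable_swap measurable_swap, Prod.swap_swap_eq, Measure.map_id]
  have hchain : klDiv ρ' (Q.prod ρ.fst) = klDiv ρ.snd Q + klDiv ρ' (ρ.snd.prod ρ.fst) := by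
    simpa only [Measure.compProd_const, hdis] using
      klDiv_compProd_eq_add ρ.snd Q ρ'.condKernel (Kernel.const β ρ.fst)
  calc mutualInfo ρ
      = klDiv (ρ'.map Prod.swap) ((ρ.snd.prod ρ.fst).map Prod.swap) := by
        rw [hback, Measure.prod_swap, mutualInfo]
    _ ≤ klDiv ρ' (ρ.snd.prod ρ.fst) := klDiv_map_le _ _ measurable_swap
    _ ≤ klDiv ρ' (Q.prod ρ.fst) := hchain ▸ le_add_self
    _ = klDiv (ρ.map Prod.swap) ((ρ.fst.prod Q).map Prod.swap) := by rw [Measure.prod_swap]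
    _ ≤ klDiv ρ (ρ.fst.prod Q) := klDiv_map_le _ _ measurable_swap

end KullbackLeibler

section ConditionalMutualInformation

variable {D S Y T : Type*} [MeasurableSpace D] [MeasurableSpace S] [MeasurableSpace Y]
  [MeasurableSpace T]

lemma map_compProd_prod_eq_map_compProd_comap {P : Measure D} [SFinite P] {g : D → S}
    (hg : Measurable g) {w : D → T} (hw : Measurable w) {η : Kernel T S} [IsSFiniteKernel η]
    (hη : P.map w ⊗ₘ η = P.map fun x => (w x, g x)) (Q : Kernel T Y) [IsSFiniteKernel Q] :
    P.map w ⊗ₘ (η ×ₖ Q) = (P ⊗ₘ Q.comap w hw).map fun p => (w p.1, g p.1, p.2) := by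
  refine Measure.ext_of_lintegral _ fun h hh => ?_
  have hmeas : Measurable fun q : T × S => ∫⁻ y, h (q.1, q.2, y) ∂(Q q.1) :=
    Measurable.lintegral_kernel_prod_right' (κ := Q.prodMkRight S)
      (f := fun q => h (q.1.1, q.1.2, q.2)) (by fun_prop)
  calc ∫⁻ q, h q ∂(P.map w ⊗ₘ (η ×ₖ Q))
      = ∫⁻ c, ∫⁻ s, ∫⁻ y, h (c, s, y) ∂(Q c) ∂(η c) ∂(P.map w) := by
        rw [Measure.lintegral_compProd hh]
        exact lintegral_congr fun c => Kernel.lintegral_prod _ _ _ (by fun_prop)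
    _ = ∫⁻ q, ∫⁻ y, h (q.1, q.2, y) ∂(Q q.1) ∂(P.map fun x => (w x, g x)) := by
        rw [← hη, Measure.lintegral_compProd hmeas]
    _ = ∫⁻ x, ∫⁻ y, h (w x, g x, y) ∂(Q (w x)) ∂P := by
        rw [lintegral_map hmeas (by fun_prop)]
    _ = ∫⁻ q, h q ∂((P ⊗ₘ Q.comap w hw).map fun p => (w p.1, g p.1, p.2)) := by
        rw [lintegral_map hh (by fun_prop), Measure.lintegral_compProd (by fun_prop)]
        rfl

variable [StandardBorelSpace S] [Nonempty S] [StandardBorelSpace Y] [Nonempty Y]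

lemma condMutualInfo_compProd_le_lintegral_klDiv (P : Measure D) [IsProbabilityMeasure P]
    (K : Kernel D Y) [IsMarkovKernel K] {g : D → S} (hg : Measurable g) {w : D → T}
    (hw : Measurable w) (Q : Kernel T Y) [IsMarkovKernel Q] :
    condMutualInfo (fun p : D × Y => g p.1) (fun p => p.2) (fun p => w p.1) (P ⊗ₘ K) ≤
      ∫⁻ x, klDiv (K x) (Q (w x)) ∂P := by
  set κ := condDistrib (fun p : D × Y => (g p.1, p.2)) (fun p => w p.1) (P ⊗ₘ K) with hκ
  have hW : (P ⊗ₘ K).map (fun p => w p.1) = P.map w := by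
    rw [← Function.comp_def w Prod.fst, ← Measure.map_map hw measurable_fst, ← Measure.fst,
      Measure.fst_compProd]
  have hjoint : P.map w ⊗ₘ κ = (P ⊗ₘ K).map fun p => (w p.1, g p.1, p.2) := by
    rw [hκ, ← hW, compProd_map_condDistrib (by fun_prop)]
  have href : P.map w ⊗ₘ (κ.fst ×ₖ Q) =
      (P ⊗ₘ Q.comap w hw).map fun p => (w p.1, g p.1, p.2) := by
    refine map_compProd_prod_eq_map_compProd_comap hg hw ?_ Q
    calc P.map w ⊗ₘ κ.fst = ((P ⊗ₘ K).map fun p => (w p.1, g p.1, p.2)).map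
          (Prod.map id Prod.fst) := by
          rw [Kernel.fst_eq, Measure.compProd_map measurable_fst, hjoint]
      _ = (P ⊗ₘ K).fst.map fun x => (w x, g x) := by
          rw [Measure.map_map (by fun_prop) (by fun_prop), Measure.fst,
            Measure.map_map (by fun_prop) measurable_fst]
          rfl
      _ = P.map fun x => (w x, g x) := by rw [Measure.fst_compProd]
  have := Measure.isProbabilityMeasure_map (μ := P) hw.aemeasurable
  calc condMutualInfo (fun p : D × Y => g p.1) (fun p => p.2) (fun p => w p.1) (P ⊗ₘ K)
      ≤ ∫⁻ c, klDiv (κ c) ((κ.fst ×ₖ Q) c) ∂(P.map w) := by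
        rw [condMutualInfo, hW]
        refine lintegral_mono fun c => ?_
        rw [Kernel.prod_apply, Kernel.fst_apply]
        exact mutualInfo_le_klDiv_prod (κ c) (Q c)
    _ = klDiv ((P ⊗ₘ K).map fun p => (w p.1, g p.1, p.2))
          ((P ⊗ₘ Q.comap w hw).map fun p => (w p.1, g p.1, p.2)) := by
        rw [← klDiv_compProd_eq_lintegral, hjoint, href]
    _ ≤ klDiv (P ⊗ₘ K) (P ⊗ₘ Q.comap w hw) := klDiv_map_le _ _ (by fun_prop)
    _ = ∫⁻ x, klDiv (K x) (Q (w x)) ∂P := klDiv_compProd_eq_lintegral P K (Q.comap w hw)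

end ConditionalMutualInformation

section Gaussian

variable {V : Type*} [NormedAddCommGroup V] [InnerProductSpace ℝ V]

/-- The logarithm of the Lebesgue density of the centred Gaussian law with covariance `s • 1` on a
finite-dimensional Euclidean space. -/
noncomputable def gaussianLogDensity (s : ℝ) (z : V) : ℝ :=
  -(Module.finrank ℝ V / 2) * Real.log (2 * Real.pi * s) - ‖z‖ ^ 2 / (2 * s)

@[fun_prop]
lemma continuous_gaussianLogDensity (s : ℝ) : Continuous (gaussianLogDensity (V := V) s) := by
  unfold gaussianLogDensity; fun_prop

lemma exp_gaussianLogDensity {s : ℝ} (hs : 0 < s) (z : V) :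
    Real.exp (gaussianLogDensity s z) =
      (Real.pi / (1 / (2 * s))) ^ (-(Module.finrank ℝ V / 2 : ℝ)) *
        Real.exp (-(1 / (2 * s)) * ‖z‖ ^ 2) := by
  rw [gaussianLogDensity, sub_eq_add_neg, Real.exp_add, Real.rpow_def_of_pos (by positivity)]
  congr 2 <;> field_simp

variable [MeasurableSpace V] [BorelSpace V] [FiniteDimensional ℝ V]

lemma integrable_exp_gaussianLogDensity {s : ℝ} (hs : 0 < s) :
    Integrable fun z : V => Real.exp (gaussianLogDensity s z) := by
  simp_rw [exp_gaussianLogDensity hs]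
  refine Integrable.const_mul (Integrable.of_integral_ne_zero ?_) _
  rw [GaussianFourier.integral_rexp_neg_mul_sq_norm (by positivity)]
  positivity

lemma charFun_withDensity_exp_gaussianLogDensity {s : ℝ} (hs : 0 < s) (t : V) :
    charFun (volume.withDensity fun z => ENNReal.ofReal (Real.exp (gaussianLogDensity s z))) t =
      Complex.exp (-(s * ‖t‖ ^ 2 / 2)) := by
  set b : ℝ := 1 / (2 * s) with hb
  have hbpos : 0 < b := by positivity
  set r : ℝ := Module.finrank ℝ V / 2 with hr
  have hintegrand (z : V) : (ENNReal.ofReal (Real.exp (gaussianLogDensity s z))).toReal •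
      Complex.exp (inner ℝ z t * Complex.I) =
        ((Real.pi / b) ^ (-r) : ℝ) *
          Complex.exp (-(b : ℂ) * ‖z‖ ^ 2 + Complex.I * inner ℝ t z) := by
    rw [ENNReal.toReal_ofReal (Real.exp_pos _).le, exp_gaussianLogDensity hs, ← hb, ← hr,
      Complex.real_smul, Complex.exp_add, real_inner_comm]
    push_cast
    ring_nf
  have hnormalization : (((Real.pi / b) ^ (-r) : ℝ) : ℂ) *
      (Real.pi / b) ^ (Module.finrank ℝ V / 2 : ℂ) = 1 := by
    have hcast : (Real.pi / b : ℂ) ^ (Module.finrank ℝ V / 2 : ℂ) =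
        ((Real.pi / b) ^ r : ℝ) := by
      rw [Complex.ofReal_cpow (by positivity)]
      simp [hr]
    rw [hcast, ← Complex.ofReal_mul, ← Real.rpow_add (by positivity), neg_add_cancel,
      Real.rpow_zero, Complex.ofReal_one]
  rw [charFun_apply, integral_withDensity_eq_integral_toReal_smul (by fun_prop) (by simp)]
  simp_rw [hintegrand]
  rw [integral_const_mul, GaussianFourier.integral_cexp_neg_mul_sq_norm_add (by simpa using hbpos),
    ← mul_assoc, hnormalization, one_mul, Complex.I_sq, hb]
  congr 1
  push_cast
  field_simp
  norm_num

lemma map_const_add_withDensity {G : Type*} [AddGroup G] [MeasurableSpace G] [MeasurableAdd G]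
    (μ : Measure G) [μ.IsAddLeftInvariant] {ρ : G → ℝ≥0∞} (hρ : Measurable ρ) (y : G) :
    (μ.withDensity ρ).map (y + ·) = μ.withDensity fun z => ρ (-y + z) := by
  refine Measure.ext_of_lintegral _ fun h hh => ?_
  rw [lintegral_map hh (measurable_const_add y),
    lintegral_withDensity_eq_lintegral_mul _ hρ (by fun_prop),
    lintegral_withDensity_eq_lintegral_mul _ (by fun_prop) hh]
  refine Eq.trans ?_ (lintegral_add_left_eq_self _ y)
  simp only [Pi.mul_apply, neg_add_cancel_left]

lemma klDiv_withDensity_exp {Ω : Type*} [MeasurableSpace Ω] {ν : Measure Ω} [SigmaFinite ν]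
    {a b : Ω → ℝ} (ha : Measurable a) (hb : Measurable b)
    [IsProbabilityMeasure (ν.withDensity fun x => ENNReal.ofReal (Real.exp (a x)))]
    [IsProbabilityMeasure (ν.withDensity fun x => ENNReal.ofReal (Real.exp (b x)))]
    (hint : Integrable (fun x => a x - b x)
      (ν.withDensity fun x => ENNReal.ofReal (Real.exp (a x)))) :
    klDiv (ν.withDensity fun x => ENNReal.ofReal (Real.exp (a x)))
        (ν.withDensity fun x => ENNReal.ofReal (Real.exp (b x))) =
      ENNReal.ofReal
        (∫ x, a x - b x ∂(ν.withDensity fun x => ENNReal.ofReal (Real.exp (a x)))) := by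
  set μ₁ := ν.withDensity fun x => ENNReal.ofReal (Real.exp (a x)) with hμ₁
  set μ₂ := ν.withDensity fun x => ENNReal.ofReal (Real.exp (b x)) with hμ₂
  have hdens : μ₁ = μ₂.withDensity fun x => ENNReal.ofReal (Real.exp (a x - b x)) := by
    rw [hμ₂, ← withDensity_mul _ (by fun_prop) (by fun_prop), hμ₁]
    congr 1 with x
    rw [Pi.mul_apply, ← ENNReal.ofReal_mul (Real.exp_pos _).le, ← Real.exp_add,
      add_sub_cancel]
  have hac : μ₁ ≪ μ₂ := hdens ▸ withDensity_absolutelyContinuous _ _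
  have hllr : llr μ₁ μ₂ =ᵐ[μ₁] fun x => a x - b x := by
    have hrn : μ₁.rnDeriv μ₂ =ᵐ[μ₂] fun x => ENNReal.ofReal (Real.exp (a x - b x)) := by
      rw [hdens]
      exact Measure.rnDeriv_withDensity _ (by fun_prop)
    filter_upwards [hac.ae_le hrn] with x hx
    rw [llr, hx, ENNReal.toReal_ofReal (Real.exp_pos _).le, Real.log_exp]
  rw [klDiv_of_ac_of_integrable hac (hint.congr hllr.symm), integral_congr_ae hllr]
  simp

lemma charFun_isotropicGaussian (ℓ : ℕ) (σ : ℝ) (t : EuclideanSpace ℝ (Fin ℓ)) :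
    charFun (isotropicGaussian ℓ σ) t = Complex.exp (-(σ ^ 2 * ‖t‖ ^ 2 / 2)) := by
  have hquad : t.ofLp ⬝ᵥ (σ ^ 2 • (1 : Matrix (Fin ℓ) (Fin ℓ) ℝ)).mulVec t.ofLp =
      σ ^ 2 * ‖t‖ ^ 2 := by
    rw [Matrix.smul_mulVec, Matrix.one_mulVec, dotProduct_smul, smul_eq_mul,
      EuclideanSpace.real_norm_sq_eq]
    simp [dotProduct, sq]
  rw [isotropicGaussian,
    charFun_multivariateGaussian (Matrix.PosSemidef.one.smul (sq_nonneg σ)), hquad]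
  simp

lemma isotropicGaussian_eq_withDensity (ℓ : ℕ) {σ : ℝ} (hσ : σ ≠ 0) :
    isotropicGaussian ℓ σ =
      volume.withDensity fun z => ENNReal.ofReal (Real.exp (gaussianLogDensity (σ ^ 2) z)) := by
  have hs : 0 < σ ^ 2 := by positivity
  have := isFiniteMeasure_withDensity_ofReal
    (integrable_exp_gaussianLogDensity (V := EuclideanSpace ℝ (Fin ℓ)) hs).2
  refine Measure.ext_of_charFun (funext fun t => ?_)
  rw [charFun_isotropicGaussian, charFun_withDensity_exp_gaussianLogDensity hs, Complex.ofReal_pow]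

lemma memLp_id_isotropicGaussian (ℓ : ℕ) (σ : ℝ) : MemLp id 2 (isotropicGaussian ℓ σ) :=
  IsGaussian.memLp_two_id (μ := multivariateGaussian _ _)

lemma integral_id_isotropicGaussian (ℓ : ℕ) (σ : ℝ) : ∫ z, z ∂(isotropicGaussian ℓ σ) = 0 :=
  integral_id_multivariateGaussian

lemma integral_sq_norm_isotropicGaussian (ℓ : ℕ) (σ : ℝ) :
    ∫ z, ‖z‖ ^ 2 ∂(isotropicGaussian ℓ σ) = ℓ * σ ^ 2 := by
  have hmem (i) : MemLp (fun z : EuclideanSpace ℝ (Fin ℓ) => z i) 2 (isotropicGaussian ℓ σ) :=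
    (memLp_id_isotropicGaussian ℓ σ).continuousLinearMap_comp (EuclideanSpace.proj (𝕜 := ℝ) i)
  have hmean (i) : ∫ z : EuclideanSpace ℝ (Fin ℓ), z i ∂(isotropicGaussian ℓ σ) = 0 := by
    have h := (EuclideanSpace.proj (𝕜 := ℝ) i).integral_comp_comm
      ((memLp_id_isotropicGaussian ℓ σ).integrable one_le_two)
    simpa [integral_id_isotropicGaussian] using h
  have hvar (i) : ∫ z : EuclideanSpace ℝ (Fin ℓ), z i ^ 2 ∂(isotropicGaussian ℓ σ) = σ ^ 2 := by
    have h := variance_eval_multivariateGaussian (μ := 0)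
      (Matrix.PosSemidef.one.smul (sq_nonneg σ) : (σ ^ 2 • (1 : Matrix (Fin ℓ) _ ℝ)).PosSemidef) i
    rw [← isotropicGaussian, variance_of_integral_eq_zero (hmem i).aemeasurable (hmean i)] at h
    simpa using h
  simp_rw [EuclideanSpace.real_norm_sq_eq]
  rw [integral_finsetSum _ fun i _ => (hmem i).integrable_sq]
  simp [hvar]

end Gaussian

section GaussianChannel

variable {ℓ : ℕ}

/-- The additive Gaussian noise channel `y ↦ N(y, σ² I_ℓ)`. -/
noncomputable def gaussianChannel (ℓ : ℕ) (σ : ℝ) :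
    Kernel (EuclideanSpace ℝ (Fin ℓ)) (EuclideanSpace ℝ (Fin ℓ)) :=
  (Kernel.id ×ₖ Kernel.const _ (isotropicGaussian ℓ σ)).map fun p => p.1 + p.2

instance (ℓ : ℕ) (σ : ℝ) : IsMarkovKernel (gaussianChannel ℓ σ) :=
  Kernel.IsMarkovKernel.map _ (by fun_prop)

lemma gaussianChannel_apply (σ : ℝ) (y : EuclideanSpace ℝ (Fin ℓ)) :
    gaussianChannel ℓ σ y = (isotropicGaussian ℓ σ).map (y + ·) := by
  rw [gaussianChannel, Kernel.map_apply _ (by fun_prop), Kernel.prod_apply, Kernel.id_apply,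
    Kernel.const_apply, Measure.dirac_prod, Measure.map_map (by fun_prop) (by fun_prop)]
  rfl

lemma gaussianChannel_eq_withDensity {σ : ℝ} (hσ : σ ≠ 0) (y : EuclideanSpace ℝ (Fin ℓ)) :
    gaussianChannel ℓ σ y = volume.withDensity fun z =>
      ENNReal.ofReal (Real.exp (gaussianLogDensity (σ ^ 2) (-y + z))) := by
  rw [gaussianChannel_apply, isotropicGaussian_eq_withDensity ℓ hσ,
    map_const_add_withDensity _ (by fun_prop)]

lemma gaussianLogDensity_sub_gaussianLogDensity_add {s t : ℝ} (hs : 0 < s) (ht : 0 < t)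
    (u z : EuclideanSpace ℝ (Fin ℓ)) :
    gaussianLogDensity s z - gaussianLogDensity t (u + z) =
      ℓ / 2 * Real.log (t / s) + ‖u‖ ^ 2 / (2 * t) + inner ℝ u z / t +
        (1 / (2 * t) - 1 / (2 * s)) * ‖z‖ ^ 2 := by
  rw [gaussianLogDensity, gaussianLogDensity, finrank_euclideanSpace_fin, norm_add_sq_real,
    Real.log_div ht.ne' hs.ne', Real.log_mul (by positivity) ht.ne',
    Real.log_mul (by positivity) hs.ne']
  ring

lemma integrable_gaussianLogDensity_sub_gaussianLogDensity_add (σ τ : ℝ)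
    (u : EuclideanSpace ℝ (Fin ℓ)) :
    Integrable (fun z => gaussianLogDensity (σ ^ 2) z - gaussianLogDensity (τ ^ 2) (u + z))
      (isotropicGaussian ℓ σ) := by
  have hid := memLp_id_isotropicGaussian ℓ σ
  have hshift : MemLp (fun z => u + z) 2 (isotropicGaussian ℓ σ) := (memLp_const u).add hid
  exact ((integrable_const _).sub ((hid.integrable_norm_pow two_ne_zero).div_const _)).sub
    ((integrable_const _).sub ((hshift.integrable_norm_pow two_ne_zero).div_const _))

lemma integral_gaussianLogDensity_sub_gaussianLogDensity_add {σ τ : ℝ} (hσ : σ ≠ 0) (hτ : τ ≠ 0)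
    (u : EuclideanSpace ℝ (Fin ℓ)) :
    ∫ z, gaussianLogDensity (σ ^ 2) z - gaussianLogDensity (τ ^ 2) (u + z)
        ∂(isotropicGaussian ℓ σ) =
      ℓ / 2 * (Real.log (τ ^ 2 / σ ^ 2) + σ ^ 2 / τ ^ 2 - 1) + ‖u‖ ^ 2 / (2 * τ ^ 2) := by
  have hid := (memLp_id_isotropicGaussian ℓ σ).integrable one_le_two
  have hinner : Integrable (fun z => inner ℝ u z / τ ^ 2) (isotropicGaussian ℓ σ) :=
    (hid.const_inner u).div_const _
  have hlin : Integrable (fun z => ℓ / 2 * Real.log (τ ^ 2 / σ ^ 2) + ‖u‖ ^ 2 / (2 * τ ^ 2) +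
      inner ℝ u z / τ ^ 2) (isotropicGaussian ℓ σ) :=
    (integrable_const _).add hinner
  have hsq : Integrable (fun z => (1 / (2 * τ ^ 2) - 1 / (2 * σ ^ 2)) * ‖z‖ ^ 2)
      (isotropicGaussian ℓ σ) :=
    ((memLp_id_isotropicGaussian ℓ σ).integrable_norm_pow two_ne_zero).const_mul _
  have hmean : ∫ z, inner ℝ u z ∂(isotropicGaussian ℓ σ) = 0 := by
    have h := integral_inner (𝕜 := ℝ) hid u
    simpa only [id, integral_id_isotropicGaussian, inner_zero_right] using h
  simp_rw [gaussianLogDensity_sub_gaussianLogDensity_add (sq_pos_of_ne_zero hσ)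
    (sq_pos_of_ne_zero hτ) u]
  rw [integral_add hlin hsq, integral_add (integrable_const _) hinner, integral_div, hmean,
    integral_const_mul, integral_sq_norm_isotropicGaussian, integral_const, probReal_univ, one_smul]
  field_simp
  ring

theorem klDiv_gaussianChannel {σ τ : ℝ} (hσ : σ ≠ 0) (hτ : τ ≠ 0)
    (y m : EuclideanSpace ℝ (Fin ℓ)) :
    klDiv (gaussianChannel ℓ σ y) (gaussianChannel ℓ τ m) =
      ENNReal.ofReal (ℓ / 2 * (Real.log (τ ^ 2 / σ ^ 2) + σ ^ 2 / τ ^ 2 - 1) +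
        ‖y - m‖ ^ 2 / (2 * τ ^ 2)) := by
  have hshift (z : EuclideanSpace ℝ (Fin ℓ)) :
      gaussianLogDensity (σ ^ 2) (-y + (y + z)) - gaussianLogDensity (τ ^ 2) (-m + (y + z)) =
        gaussianLogDensity (σ ^ 2) z - gaussianLogDensity (τ ^ 2) (y - m + z) := by
    congr 2 <;> abel
  have hσm := gaussianChannel_eq_withDensity hσ y
  have hτm := gaussianChannel_eq_withDensity hτ m
  have hσprob : IsProbabilityMeasure (volume.withDensity fun z =>
      ENNReal.ofReal (Real.exp (gaussianLogDensity (σ ^ 2) (-y + z)))) := hσm ▸ inferInstance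
  have hτprob : IsProbabilityMeasure (volume.withDensity fun z =>
      ENNReal.ofReal (Real.exp (gaussianLogDensity (τ ^ 2) (-m + z)))) := hτm ▸ inferInstance
  rw [hσm, hτm, klDiv_withDensity_exp (by fun_prop) (by fun_prop), ← hσm, gaussianChannel_apply,
    integral_map (by fun_prop) (Measurable.aestronglyMeasurable (by fun_prop))]
  · simp_rw [hshift, integral_gaussianLogDensity_sub_gaussianLogDensity_add hσ hτ]
  · rw [← hσm, gaussianChannel_apply,
      integrable_map_measure (Measurable.aestronglyMeasurable (by fun_prop)) (by fun_prop)]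
    simpa only [Function.comp_def, hshift] using
      integrable_gaussianLogDensity_sub_gaussianLogDensity_add σ τ (y - m)

end GaussianChannel

section Projection

variable {d ℓ : ℕ}

/-- The projection `Aᵀ y` of the query value `y`, as a vector of Euclidean space. -/
noncomputable def projectVec (A : Matrix (Fin d) (Fin ℓ) ℝ) (y : EuclideanSpace ℝ (Fin d)) :
    EuclideanSpace ℝ (Fin ℓ) :=
  WithLp.toLp 2 (A.transpose.mulVec y.ofLp)

lemma projectVec_apply (A : Matrix (Fin d) (Fin ℓ) ℝ) (y : EuclideanSpace ℝ (Fin d))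
    (r : Fin ℓ) : projectVec A y r = inner ℝ (column A r) y := by
  simp [projectVec, column, Matrix.mulVec, dotProduct, PiLp.inner_apply, mul_comm]

lemma projectVec_sub (A : Matrix (Fin d) (Fin ℓ) ℝ) (y z : EuclideanSpace ℝ (Fin d)) :
    projectVec A (y - z) = projectVec A y - projectVec A z := by
  ext r
  simp [projectVec_apply, inner_sub_right]

lemma enorm_sq_projectVec (A : Matrix (Fin d) (Fin ℓ) ℝ) (y : EuclideanSpace ℝ (Fin d)) :
    ‖projectVec A y‖ₑ ^ 2 = ∑ r, ‖inner ℝ (column A r) y‖ₑ ^ 2 := by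
  simp_rw [← projectVec_apply, ← ofReal_norm, ← ENNReal.ofReal_pow (norm_nonneg _),
    EuclideanSpace.norm_sq_eq]
  exact ENNReal.ofReal_sum_of_nonneg fun _ _ => by positivity

@[fun_prop]
lemma measurable_projectVec :
    Measurable fun p : Matrix (Fin d) (Fin ℓ) ℝ × EuclideanSpace ℝ (Fin d) =>
      projectVec p.1 p.2 := by
  have hpair : Measurable fun p : Matrix (Fin d) (Fin ℓ) ℝ × EuclideanSpace ℝ (Fin d) =>
      (p.2, (p.1, (0 : EuclideanSpace ℝ (Fin ℓ)))) := by fun_prop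
  simpa only [Function.comp_def, projectedOutput, projectVec, add_zero, id] using
    (measurable_projectedOutput measurable_id).comp hpair

@[fun_prop]
lemma measurable_column (r : Fin ℓ) :
    Measurable fun A : Matrix (Fin d) (Fin ℓ) ℝ => column A r :=
  (WithLp.measurable_toLp 2 _).comp (measurable_pi_lambda _ fun i =>
    (measurable_pi_apply r).comp (measurable_pi_apply i))

end Projection

section Moments

variable {d ℓ : ℕ} {ρ : Measure (EuclideanSpace ℝ (Fin d))}

lemma memLp_inner (hρ : MemLp id 2 ρ) (φ : EuclideanSpace ℝ (Fin d)) :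
    MemLp (fun y => inner ℝ φ y) 2 ρ :=
  hρ.continuousLinearMap_comp (innerSL ℝ φ)

variable [IsFiniteMeasure ρ]

lemma integral_inner_eq_inner_meanVector (hρ : MemLp id 2 ρ) (φ : EuclideanSpace ℝ (Fin d)) :
    ∫ y, inner ℝ φ y ∂ρ = inner ℝ φ (meanVector ρ) :=
  integral_inner (hρ.integrable one_le_two) φ

lemma variance_inner_eq_inner_covarianceMatrix (hρ : MemLp id 2 ρ)
    (φ : EuclideanSpace ℝ (Fin d)) :
    Var[fun y => inner ℝ φ y; ρ] =
      inner ℝ φ (Matrix.toEuclideanCLM (n := Fin d) (𝕜 := ℝ) (covarianceMatrix ρ) φ) := by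
  have hmem (i) : MemLp (fun y : EuclideanSpace ℝ (Fin d) => φ i * y i) 2 ρ :=
    (hρ.continuousLinearMap_comp (EuclideanSpace.proj (𝕜 := ℝ) i)).const_mul (φ i)
  have hsum : (fun y : EuclideanSpace ℝ (Fin d) => inner ℝ φ y) = fun y => ∑ i, φ i * y i := by
    ext y
    simp [PiLp.inner_apply, mul_comm]
  rw [hsum, variance_fun_sum' fun i _ => hmem i]
  simp only [covariance_const_mul_left, covariance_const_mul_right, PiLp.inner_apply,
    Matrix.ofLp_toEuclideanCLM, Matrix.mulVec, dotProduct, covarianceMatrix, Matrix.of_apply,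
    RCLike.inner_apply, conj_trivial, Finset.sum_mul]
  exact Finset.sum_congr rfl fun i _ => Finset.sum_congr rfl fun j _ => by ring

lemma ofReal_variance_inner_le (hρ : MemLp id 2 ρ) (φ : EuclideanSpace ℝ (Fin d)) :
    ENNReal.ofReal Var[fun y => inner ℝ φ y; ρ] ≤ opENorm (covarianceMatrix ρ) * ‖φ‖ₑ ^ 2 := by
  set C := Matrix.toEuclideanCLM (n := Fin d) (𝕜 := ℝ) (covarianceMatrix ρ)
  have hle : Var[fun y => inner ℝ φ y; ρ] ≤ ‖C‖ * ‖φ‖ ^ 2 := calc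
    Var[fun y => inner ℝ φ y; ρ] = inner ℝ φ (C φ) :=
      variance_inner_eq_inner_covarianceMatrix hρ φ
    _ ≤ ‖φ‖ * ‖C φ‖ := real_inner_le_norm _ _
    _ ≤ ‖φ‖ * (‖C‖ * ‖φ‖) := by gcongr; exact C.le_opNorm φ
    _ = ‖C‖ * ‖φ‖ ^ 2 := by ring
  refine (ENNReal.ofReal_le_ofReal hle).trans_eq ?_
  rw [ENNReal.ofReal_mul (norm_nonneg _), ENNReal.ofReal_pow (norm_nonneg _), ofReal_norm,
    ofReal_norm, opENorm]

lemma lintegral_inner_sub_meanVector_le (hρ : MemLp id 2 ρ) (φ : EuclideanSpace ℝ (Fin d)) :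
    ∫⁻ y, ‖inner ℝ φ (y - meanVector ρ)‖ₑ ^ 2 ∂ρ ≤ opENorm (covarianceMatrix ρ) * ‖φ‖ₑ ^ 2 := by
  refine le_of_eq_of_le ?_ (ofReal_variance_inner_le hρ φ)
  rw [(memLp_inner hρ φ).ofReal_variance_eq, evariance, integral_inner_eq_inner_meanVector hρ]
  simp_rw [inner_sub_right]

lemma lintegral_inner_le [IsProbabilityMeasure ρ] (hρ : MemLp id 2 ρ)
    (φ : EuclideanSpace ℝ (Fin d)) :
    ∫⁻ y, ‖inner ℝ φ y‖ₑ ^ 2 ∂ρ ≤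
      (opENorm (covarianceMatrix ρ) + ‖meanVector ρ‖ₑ ^ 2) * ‖φ‖ₑ ^ 2 := by
  have hmem := memLp_inner hρ φ
  have hsq : ∫ y, (inner ℝ φ y) ^ 2 ∂ρ =
      Var[fun y => inner ℝ φ y; ρ] + ‖inner ℝ φ (meanVector ρ)‖ ^ 2 := by
    rw [variance_eq_sub hmem, integral_inner_eq_inner_meanVector hρ, Real.norm_eq_abs, sq_abs,
      sub_add_cancel]
    rfl
  calc ∫⁻ y, ‖inner ℝ φ y‖ₑ ^ 2 ∂ρ
      = ENNReal.ofReal (∫ y, (inner ℝ φ y) ^ 2 ∂ρ) := by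
        rw [ofReal_integral_eq_lintegral_ofReal hmem.integrable_sq 
          (ae_of_all _ fun _ => sq_nonneg _)]
        simp_rw [← ofReal_norm, ← ENNReal.ofReal_pow (norm_nonneg _), Real.norm_eq_abs, sq_abs]
    _ = ENNReal.ofReal Var[fun y => inner ℝ φ y; ρ] + ‖inner ℝ φ (meanVector ρ)‖ₑ ^ 2 := by
        rw [hsq, ENNReal.ofReal_add (variance_nonneg _ _) (by positivity),
          ENNReal.ofReal_pow (norm_nonneg _), ofReal_norm]
    _ ≤ opENorm (covarianceMatrix ρ) * ‖φ‖ₑ ^ 2 + (‖φ‖ₑ * ‖meanVector ρ‖ₑ) ^ 2 := by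
        gcongr
        · exact ofReal_variance_inner_le hρ φ
        · simpa only [enorm, ← ENNReal.coe_mul, ENNReal.coe_le_coe] using
            nnnorm_inner_le_nnnorm (𝕜 := ℝ) φ (meanVector ρ)
    _ = (opENorm (covarianceMatrix ρ) + ‖meanVector ρ‖ₑ ^ 2) * ‖φ‖ₑ ^ 2 := by ring

lemma lintegral_projectVec_sub_meanVector_le (hρ : MemLp id 2 ρ) (A : Matrix (Fin d) (Fin ℓ) ℝ) :
    ∫⁻ y, ‖projectVec A (y - meanVector ρ)‖ₑ ^ 2 ∂ρ ≤
      opENorm (covarianceMatrix ρ) * ∑ r, ‖column A r‖ₑ ^ 2 := by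
  simp_rw [enorm_sq_projectVec]
  rw [lintegral_finsetSum _ fun r _ => by fun_prop, Finset.mul_sum]
  exact Finset.sum_le_sum fun r _ => lintegral_inner_sub_meanVector_le hρ _

lemma lintegral_projectVec_le [IsProbabilityMeasure ρ] (hρ : MemLp id 2 ρ)
    (A : Matrix (Fin d) (Fin ℓ) ℝ) :
    ∫⁻ y, ‖projectVec A y‖ₑ ^ 2 ∂ρ ≤
      (opENorm (covarianceMatrix ρ) + ‖meanVector ρ‖ₑ ^ 2) * ∑ r, ‖column A r‖ₑ ^ 2 := by
  simp_rw [enorm_sq_projectVec]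
  rw [lintegral_finsetSum _ fun r _ => by fun_prop, Finset.mul_sum]
  exact Finset.sum_le_sum fun r _ => lintegral_inner_le hρ _

end Moments

section ConditionalMoments

variable {D T : Type*} [MeasurableSpace D] [MeasurableSpace T] {P : Measure D} {w : D → T}

variable [IsFiniteMeasure P]

lemma lintegral_eq_lintegral_condDistrib {Y : Type*} [MeasurableSpace Y] [StandardBorelSpace Y]
    [Nonempty Y] {f : D → Y} (hf : Measurable f) (hw : Measurable w)
    {h : T × Y → ℝ≥0∞} (hh : Measurable h) :
    ∫⁻ x, h (w x, f x) ∂P = ∫⁻ x, ∫⁻ y, h (w x, y) ∂(condDistrib f w P (w x)) ∂P := by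
  calc ∫⁻ x, h (w x, f x) ∂P
      = ∫⁻ q, h q ∂(P.map w ⊗ₘ condDistrib f w P) := by
        rw [compProd_map_condDistrib hf.aemeasurable, lintegral_map hh (by fun_prop)]
    _ = ∫⁻ x, ∫⁻ y, h (w x, y) ∂(condDistrib f w P (w x)) ∂P := by
        rw [Measure.lintegral_compProd hh, lintegral_map hh.lintegral_kernel_prod_right' hw]

variable {d ℓ : ℕ} {f : D → EuclideanSpace ℝ (Fin d)}

@[fun_prop]
lemma measurable_condMean : Measurable (condMean P f w) :=
  (StronglyMeasurable.integral_condDistrib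
    (stronglyMeasurable_id.comp_measurable measurable_snd)).measurable

lemma lintegral_projectVec_sub_condMean_le (hf : Measurable f) (hw : Measurable w)
    (hmom : HasCondSecondMoment P f w) (A : Matrix (Fin d) (Fin ℓ) ℝ) :
    ∫⁻ x, ‖projectVec A (f x) - projectVec A (condMean P f w (w x))‖ₑ ^ 2 ∂P ≤
      (∫⁻ x, opENorm (condCovariance P f w (w x)) ∂P) * ∑ r, ‖column A r‖ₑ ^ 2 := by
  have hA : ∑ r, ‖column A r‖ₑ ^ 2 ≠ ∞ :=
    ENNReal.sum_ne_top.2 fun r _ => ENNReal.pow_ne_top enorm_ne_top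
  simp_rw [← projectVec_sub]
  rw [lintegral_eq_lintegral_condDistrib hf hw
    (h := fun q => ‖projectVec A (q.2 - condMean P f w q.1)‖ₑ ^ 2) (by fun_prop),
    ← lintegral_mul_const' _ _ hA]
  refine lintegral_mono_ae ?_
  filter_upwards [hmom] with x hx using lintegral_projectVec_sub_meanVector_le hx A

lemma lintegral_projectVec_comp_le (hf : Measurable f) (hw : Measurable w)
    (hmom : HasCondSecondMoment P f w) (A : Matrix (Fin d) (Fin ℓ) ℝ) :
    ∫⁻ x, ‖projectVec A (f x)‖ₑ ^ 2 ∂P ≤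
      (∫⁻ x, opENorm (condCovariance P f w (w x)) + ‖condMean P f w (w x)‖ₑ ^ 2 ∂P) *
        ∑ r, ‖column A r‖ₑ ^ 2 := by
  have hA : ∑ r, ‖column A r‖ₑ ^ 2 ≠ ∞ :=
    ENNReal.sum_ne_top.2 fun r _ => ENNReal.pow_ne_top enorm_ne_top
  rw [lintegral_eq_lintegral_condDistrib hf hw (h := fun q => ‖projectVec A q.2‖ₑ ^ 2)
    (by fun_prop), ← lintegral_mul_const' _ _ hA]
  refine lintegral_mono_ae ?_
  filter_upwards [hmom] with x hx using lintegral_projectVec_le hx A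

lemma lintegral_lintegral_projectVec_le (hf : Measurable f) (hw : Measurable w)
    (hmom : HasCondSecondMoment P f w) (ν : Measure (Matrix (Fin d) (Fin ℓ) ℝ)) [SFinite ν] :
    ∫⁻ x, ∫⁻ A, ‖projectVec A (f x)‖ₑ ^ 2 ∂ν ∂P ≤
      (∫⁻ x, opENorm (condCovariance P f w (w x)) + ‖condMean P f w (w x)‖ₑ ^ 2 ∂P) *
        ∑ r, ∫⁻ A, ‖column A r‖ₑ ^ 2 ∂ν := by
  rw [lintegral_lintegral_swap (by fun_prop), ← lintegral_finsetSum _ fun r _ => by fun_prop,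
    ← lintegral_const_mul _ (by fun_prop)]
  exact lintegral_mono fun A => lintegral_projectVec_comp_le hf hw hmom A

end ConditionalMoments

section ReferenceChannel

variable {ℓ : ℕ}

lemma klDiv_gaussianChannel_mul_exp_le (hℓ : 0 < ℓ) {σ : ℝ} (hσ : σ ≠ 0) (ε : ℝ)
    (y m : EuclideanSpace ℝ (Fin ℓ)) :
    klDiv (gaussianChannel ℓ σ y) (gaussianChannel ℓ (σ * Real.exp (ε / ℓ)) m) ≤
      ENNReal.ofReal (ε - ℓ / 2 * (1 - Real.exp (-(2 * ε / ℓ)))) +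
        ENNReal.ofReal (Real.exp (-(2 * ε / ℓ)) / (2 * σ ^ 2)) * ‖y - m‖ₑ ^ 2 := by
  have hsq : (σ * Real.exp (ε / ℓ)) ^ 2 = σ ^ 2 * Real.exp (2 * ε / ℓ) := by
    rw [mul_pow, ← Real.exp_nat_mul]
    ring_nf
  have hlog : Real.log (σ ^ 2 * Real.exp (2 * ε / ℓ) / σ ^ 2) = 2 * ε / ℓ := by
    rw [mul_div_cancel_left₀ _ (by positivity), Real.log_exp]
  rw [klDiv_gaussianChannel hσ (by positivity), hsq, hlog, ← ofReal_norm,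
    ← ENNReal.ofReal_pow (norm_nonneg _), ← ENNReal.ofReal_mul (by positivity), Real.exp_neg]
  refine le_of_eq_of_le ?_ ENNReal.ofReal_add_le
  congr 1
  field_simp
  ring

lemma ofReal_gaussianLeakage_eq (hℓ : 0 < ℓ) {σ : ℝ} (hσ : σ ≠ 0) {ε : ℝ} (hε : 0 ≤ ε) :
    ENNReal.ofReal (ε - ℓ / 2 * (1 - Real.exp (-(2 * ε / ℓ)))) +
      ENNReal.ofReal (Real.exp (-(2 * ε / ℓ)) / (2 * σ ^ 2)) *
        (ℓ * (ENNReal.ofReal (σ ^ 2) * ENNReal.ofReal (Real.exp (2 * ε / ℓ) - 1))) =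
      ENNReal.ofReal ε := by
  have hexp : 0 ≤ Real.exp (2 * ε / ℓ) - 1 := sub_nonneg.2 (Real.one_le_exp (by positivity))
  have hnonneg : 0 ≤ ε - ℓ / 2 * (1 - Real.exp (-(2 * ε / ℓ))) := by
    have h : ℓ / 2 * (1 - Real.exp (-(2 * ε / ℓ))) ≤ ℓ / 2 * (2 * ε / ℓ) := by
      gcongr
      linarith [Real.add_one_le_exp (-(2 * ε / ℓ))]
    have h' : ℓ / 2 * (2 * ε / ℓ) = ε := by field_simp
    linarith
  rw [← ENNReal.ofReal_natCast, ← ENNReal.ofReal_mul (by positivity),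
    ← ENNReal.ofReal_mul (by positivity), ← ENNReal.ofReal_mul (by positivity),
    ← ENNReal.ofReal_add hnonneg (by positivity), Real.exp_neg]
  congr 1
  field_simp
  ring

variable {D Ω : Type*} [MeasurableSpace D] [MeasurableSpace Ω] {P : Measure D} {ν : Measure Ω}

lemma lintegral_klDiv_gaussianChannel_eq_zero [SFinite ν]
    {y : D → Ω → EuclideanSpace ℝ (Fin ℓ)} (hy : Measurable (Function.uncurry y))
    {m : D → EuclideanSpace ℝ (Fin ℓ)} (hm : Measurable m)
    (hdev : ∫⁻ x, ∫⁻ ω, ‖y x ω - m x‖ₑ ^ 2 ∂ν ∂P = 0) (σ : ℝ) :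
    ∫⁻ x, ∫⁻ ω, klDiv (gaussianChannel ℓ σ (y x ω)) (gaussianChannel ℓ σ (m x)) ∂ν ∂P = 0 := by
  have hdist : Measurable fun x => ∫⁻ ω, ‖y x ω - m x‖ₑ ^ 2 ∂ν :=
    Measurable.lintegral_prod_right' (f := fun p => ‖y p.1 p.2 - m p.1‖ₑ ^ 2) (by fun_prop)
  rw [lintegral_eq_zero_iff hdist] at hdev
  refine lintegral_eq_zero_of_ae_eq_zero ?_
  filter_upwards [hdev] with x hx
  rw [Pi.zero_apply, lintegral_eq_zero_iff (by fun_prop)] at hx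
  refine lintegral_eq_zero_of_ae_eq_zero ?_
  filter_upwards [hx] with ω hω
  have : y x ω = m x := by simpa [sub_eq_zero] using hω
  rw [this, klDiv_self, Pi.zero_apply]

lemma lintegral_klDiv_gaussianChannel_mul_exp_le [IsProbabilityMeasure P]
    [IsProbabilityMeasure ν] (hℓ : 0 < ℓ) {σ ε : ℝ} (hε : 0 ≤ ε)
    {y : D → Ω → EuclideanSpace ℝ (Fin ℓ)} (hy : Measurable (Function.uncurry y))
    {m : D → EuclideanSpace ℝ (Fin ℓ)} (hm : Measurable m)
    (hdev : ∫⁻ x, ∫⁻ ω, ‖y x ω - m x‖ₑ ^ 2 ∂ν ∂P ≤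
      ℓ * (ENNReal.ofReal (σ ^ 2) * ENNReal.ofReal (Real.exp (2 * ε / ℓ) - 1))) :
    ∫⁻ x, ∫⁻ ω, klDiv (gaussianChannel ℓ σ (y x ω))
      (gaussianChannel ℓ (σ * Real.exp (ε / ℓ)) (m x)) ∂ν ∂P ≤ ENNReal.ofReal ε := by
  obtain rfl | hσ := eq_or_ne σ 0
  · have hdev₀ : ∫⁻ x, ∫⁻ ω, ‖y x ω - m x‖ₑ ^ 2 ∂ν ∂P = 0 := by simpa using hdev
    rw [zero_mul, lintegral_klDiv_gaussianChannel_eq_zero hy hm hdev₀]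
    exact zero_le
  set a := ENNReal.ofReal (ε - ℓ / 2 * (1 - Real.exp (-(2 * ε / ℓ))))
  set b := ENNReal.ofReal (Real.exp (-(2 * ε / ℓ)) / (2 * σ ^ 2))
  calc _ ≤ ∫⁻ x, ∫⁻ ω, a + b * ‖y x ω - m x‖ₑ ^ 2 ∂ν ∂P :=
        lintegral_mono fun x => lintegral_mono fun ω =>
          klDiv_gaussianChannel_mul_exp_le hℓ hσ ε (y x ω) (m x)
    _ = a + b * ∫⁻ x, ∫⁻ ω, ‖y x ω - m x‖ₑ ^ 2 ∂ν ∂P := by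
        simp_rw [lintegral_add_left measurable_const, lintegral_const, measure_univ, mul_one,
          lintegral_const_mul' b _ ENNReal.ofReal_ne_top]
    _ ≤ a + b * (ℓ * (ENNReal.ofReal (σ ^ 2) * ENNReal.ofReal (Real.exp (2 * ε / ℓ) - 1))) := by
        gcongr
    _ = ENNReal.ofReal ε := ofReal_gaussianLeakage_eq hℓ hσ hε

end ReferenceChannel

section Mechanism

variable {D S T : Type*} [MeasurableSpace D] [MeasurableSpace S] [MeasurableSpace T] {d ℓ : ℕ}
  {f : D → EuclideanSpace ℝ (Fin d)} (hf : Measurable f)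
  (ν : Measure (Matrix (Fin d) (Fin ℓ) ℝ)) [IsProbabilityMeasure ν]

lemma projectedGaussianMechanism_apply (σ : ℝ) (x : D) :
    projectedGaussianMechanism f hf ν σ x =
      (gaussianChannel ℓ σ).comap (fun A => projectVec A (f x)) (by fun_prop) ∘ₘ ν := by
  have hout := measurable_projectedOutput (ℓ := ℓ) hf
  refine Measure.ext_of_lintegral _ fun h hh => ?_
  rw [projectedGaussianMechanism, Kernel.map_apply _ hout, lintegral_map hh hout,
    Kernel.prod_apply, Kernel.id_apply, Kernel.const_apply, Measure.dirac_prod,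
    lintegral_map (by fun_prop) (by fun_prop), lintegral_prod _ (by fun_prop),
    Measure.lintegral_bind (Kernel.aemeasurable _) hh.aemeasurable]
  refine lintegral_congr fun A => ?_
  rw [Kernel.comap_apply, gaussianChannel_apply, lintegral_map hh (by fun_prop)]
  rfl

lemma klDiv_projectedGaussianMechanism_le (σ : ℝ) (x : D)
    (Q : Measure (EuclideanSpace ℝ (Fin ℓ))) [IsFiniteMeasure Q] :
    klDiv (projectedGaussianMechanism f hf ν σ x) Q ≤
      ∫⁻ A, klDiv (gaussianChannel ℓ σ (projectVec A (f x))) Q ∂ν := by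
  rw [projectedGaussianMechanism_apply]
  exact klDiv_comp_le_lintegral ν _ Q

variable [StandardBorelSpace S] [Nonempty S] (P : Measure D) [IsProbabilityMeasure P]
  {g : D → S} {w : D → T}

theorem condMutualInfo_projectedGaussianMechanism_le (hℓ : 0 < ℓ) {σ ε : ℝ} (hε : 0 ≤ ε)
    (hg : Measurable g) (hw : Measurable w) {m : T → EuclideanSpace ℝ (Fin ℓ)} (hm : Measurable m)
    (hdev : ∫⁻ x, ∫⁻ A, ‖projectVec A (f x) - m (w x)‖ₑ ^ 2 ∂ν ∂P ≤
      ℓ * (ENNReal.ofReal (σ ^ 2) * ENNReal.ofReal (Real.exp (2 * ε / ℓ) - 1))) :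
    condMutualInfo (fun p : D × EuclideanSpace ℝ (Fin ℓ) => g p.1) (fun p => p.2)
      (fun p => w p.1) (P ⊗ₘ projectedGaussianMechanism f hf ν σ) ≤ ENNReal.ofReal ε := by
  calc _ ≤ ∫⁻ x, klDiv (projectedGaussianMechanism f hf ν σ x)
        (gaussianChannel ℓ (σ * Real.exp (ε / ℓ)) (m (w x))) ∂P :=
        condMutualInfo_compProd_le_lintegral_klDiv P _ hg hw
          ((gaussianChannel ℓ (σ * Real.exp (ε / ℓ))).comap m hm)
    _ ≤ ∫⁻ x, ∫⁻ A, klDiv (gaussianChannel ℓ σ (projectVec A (f x)))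
          (gaussianChannel ℓ (σ * Real.exp (ε / ℓ)) (m (w x))) ∂ν ∂P :=
        lintegral_mono fun x => klDiv_projectedGaussianMechanism_le hf ν σ x _
    _ ≤ ENNReal.ofReal ε :=
        lintegral_klDiv_gaussianChannel_mul_exp_le hℓ hε (y := fun x A => projectVec A (f x))
          (by fun_prop) (hm.comp hw) hdev

theorem condMutualInfo_projectedGaussianMechanism_dirac_le (hℓ : 0 < ℓ) {σ ε : ℝ} (hε : 0 ≤ ε)
    (hg : Measurable g) (hw : Measurable w) (hmom : HasCondSecondMoment P f w)
    (A : Matrix (Fin d) (Fin ℓ) ℝ)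
    (hσ : (∫⁻ x, opENorm (condCovariance P f w (w x)) ∂P) * (⨆ r, ‖column A r‖ₑ ^ 2) ≤
      ENNReal.ofReal (σ ^ 2) * ENNReal.ofReal (Real.exp (2 * ε / ℓ) - 1)) :
    condMutualInfo (fun p : D × EuclideanSpace ℝ (Fin ℓ) => g p.1) (fun p => p.2)
      (fun p => w p.1) (P ⊗ₘ projectedGaussianMechanism f hf (Measure.dirac A) σ) ≤
        ENNReal.ofReal ε := by
  refine condMutualInfo_projectedGaussianMechanism_le hf _ P hℓ hε hg hw
    (m := fun c => projectVec A (condMean P f w c)) (by fun_prop) ?_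
  have hsum : ∑ r, ‖column A r‖ₑ ^ 2 ≤ ℓ * ⨆ r, ‖column A r‖ₑ ^ 2 := by
    simpa using Finset.sum_le_card_nsmul Finset.univ (fun r => ‖column A r‖ₑ ^ 2) _
      fun r _ => le_iSup (fun r => ‖column A r‖ₑ ^ 2) r
  calc ∫⁻ x, ∫⁻ B, ‖projectVec B (f x) - projectVec A (condMean P f w (w x))‖ₑ ^ 2
          ∂(Measure.dirac A) ∂P
      = ∫⁻ x, ‖projectVec A (f x) - projectVec A (condMean P f w (w x))‖ₑ ^ 2 ∂P :=
        lintegral_congr fun x => lintegral_dirac' _ (by fun_prop)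
    _ ≤ (∫⁻ x, opENorm (condCovariance P f w (w x)) ∂P) * ∑ r, ‖column A r‖ₑ ^ 2 :=
        lintegral_projectVec_sub_condMean_le hf hw hmom A
    _ ≤ (∫⁻ x, opENorm (condCovariance P f w (w x)) ∂P) * (ℓ * ⨆ r, ‖column A r‖ₑ ^ 2) := by
        gcongr
    _ ≤ _ := by
        rw [mul_left_comm]
        gcongr

theorem condMutualInfo_projectedGaussianMechanism_random_le (hℓ : 0 < ℓ) {σ ε : ℝ} (hε : 0 ≤ ε)
    (hg : Measurable g) (hw : Measurable w) (hmom : HasCondSecondMoment P f w)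
    (hν : ∀ r, ∫⁻ A, ‖column A r‖ₑ ^ 2 ∂ν ≤ 1)
    (hσ : ∫⁻ x, opENorm (condCovariance P f w (w x)) + ‖condMean P f w (w x)‖ₑ ^ 2 ∂P ≤
      ENNReal.ofReal (σ ^ 2) * ENNReal.ofReal (Real.exp (2 * ε / ℓ) - 1)) :
    condMutualInfo (fun p : D × EuclideanSpace ℝ (Fin ℓ) => g p.1) (fun p => p.2)
      (fun p => w p.1) (P ⊗ₘ projectedGaussianMechanism f hf ν σ) ≤ ENNReal.ofReal ε := by
  refine condMutualInfo_projectedGaussianMechanism_le hf ν P hℓ hε hg hw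
    (m := fun _ => 0) measurable_const ?_
  have hsum : ∑ r, ∫⁻ A, ‖column A r‖ₑ ^ 2 ∂ν ≤ ℓ := by
    simpa using Finset.sum_le_card_nsmul Finset.univ _ 1 fun r _ => hν r
  simp_rw [sub_zero]
  rw [mul_comm]
  exact (lintegral_lintegral_projectVec_le hf hw hmom ν).trans (mul_le_mul' hσ hsum)

end Mechanism

lemma lintegral_enorm_sq_eq_ofReal_integral {Ω V : Type*} [MeasurableSpace Ω]
    [SeminormedAddCommGroup V] {μ : Measure Ω} {X : Ω → V}
    (hX : Integrable (fun ω => ‖X ω‖ ^ 2) μ) :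
    ∫⁻ ω, ‖X ω‖ₑ ^ 2 ∂μ = ENNReal.ofReal (∫ ω, ‖X ω‖ ^ 2 ∂μ) := by
  rw [ofReal_integral_eq_lintegral_ofReal hX (ae_of_all _ fun _ => sq_nonneg _)]
  simp_rw [ENNReal.ofReal_pow (norm_nonneg _), ofReal_norm]

end PufferfishMI

theorem mainTheorem7_general {D : Type*} [MeasurableSpace D] {ι κ : Type*}
    {S : ι → Type*} [∀ i, MeasurableSpace (S i)] [∀ i, StandardBorelSpace (S i)]
    [∀ i, Nonempty (S i)] {T : κ → Type*} [∀ j, MeasurableSpace (T j)]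
    (g : ∀ i, D → S i) (hg : ∀ i, Measurable (g i)) (w : ∀ j, D → T j) (hw : ∀ j, Measurable (w j))
    (E : ι → κ → Prop) (Θ : Set (ProbabilityMeasure D))
    (ε : ℝ) (hε : 0 < ε) {d ℓ : ℕ} (hℓ : 0 < ℓ) (f : D → EuclideanSpace ℝ (Fin d))
    (hf : Measurable f)
    (hmom : ∀ P ∈ Θ, ∀ j ∈ activePublic E, HasCondSecondMoment (P : Measure D) f (w j)) (σ : ℝ) :
    (∀ A : Matrix (Fin d) (Fin ℓ) ℝ,
      (⨆ P ∈ Θ, ⨆ j ∈ activePublic E,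
          (∫⁻ x, opENorm (condCovariance (P : Measure D) f (w j) (w j x)) ∂P)
            * (⨆ r : Fin ℓ, ‖column A r‖ₑ ^ 2)
            / ENNReal.ofReal (Real.exp (2 * ε / ℓ) - 1)) ≤ ENNReal.ofReal (σ ^ 2) →
      IsMIPP g w E Θ ε (projectedGaussianMechanism f hf (Measure.dirac A) σ)) ∧
    (∀ (ν : Measure (Matrix (Fin d) (Fin ℓ) ℝ)) [IsProbabilityMeasure ν],
      (∀ r, ∫⁻ A, ‖column A r‖ₑ ^ 2 ∂ν ≤ 1) →
      (⨆ P ∈ Θ, ⨆ j ∈ activePublic E,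
          (∫⁻ x, (opENorm (condCovariance (P : Measure D) f (w j) (w j x))
            + ‖condMean (P : Measure D) f (w j) (w j x)‖ₑ ^ 2) ∂P)
            / ENNReal.ofReal (Real.exp (2 * ε / ℓ) - 1)) ≤ ENNReal.ofReal (σ ^ 2) →
      IsMIPP g w E Θ ε (projectedGaussianMechanism f hf ν σ)) := by
  have hexp : 0 < Real.exp (2 * ε / ℓ) - 1 := sub_pos.2 (Real.one_lt_exp_iff.2 (by positivity))
  have hbudget (b : ProbabilityMeasure D → κ → ℝ≥0∞)
      (hb : ⨆ P ∈ Θ, ⨆ j ∈ activePublic E, b P j / ENNReal.ofReal (Real.exp (2 * ε / ℓ) - 1) ≤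
        ENNReal.ofReal (σ ^ 2)) : ∀ P ∈ Θ, ∀ j ∈ activePublic E,
      b P j ≤ ENNReal.ofReal (σ ^ 2) * ENNReal.ofReal (Real.exp (2 * ε / ℓ) - 1) := by
    simpa only [iSup_le_iff, ENNReal.div_le_iff (ENNReal.ofReal_pos.2 hexp).ne'
      ENNReal.ofReal_ne_top] using hb
  refine ⟨fun A hA => iSup₂_le fun P hP => iSup₂_le fun i j => iSup_le fun hij => ?_,
    fun ν _ hν hσ => iSup₂_le fun P hP => iSup₂_le fun i j => iSup_le fun hij => ?_⟩
  · exact condMutualInfo_projectedGaussianMechanism_dirac_le hf P hℓ hε.le (hg i) (hw j)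
      (hmom P hP j ⟨i, hij⟩) A (hbudget _ hA P hP j ⟨i, hij⟩)
  · exact condMutualInfo_projectedGaussianMechanism_random_le hf ν P hℓ hε.le (hg i) (hw j)
      (hmom P hP j ⟨i, hij⟩) hν (hbudget _ hσ P hP j ⟨i, hij⟩)

theorem mainTheorem7 {𝒳 : Type*} [MeasurableSpace 𝒳] {n k : ℕ}
    {ι κ : Type*} [Finite ι] [Finite κ]
    {S : ι → Type*} [∀ i, MeasurableSpace (S i)] [∀ i, StandardBorelSpace (S i)]
    [∀ i, Nonempty (S i)] {T : κ → Type*} [∀ j, MeasurableSpace (T j)]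
    (g : ∀ i, Database 𝒳 n k → S i) (hg : ∀ i, Measurable (g i))
    (w : ∀ j, Database 𝒳 n k → T j) (hw : ∀ j, Measurable (w j))
    (E : ι → κ → Prop) (Θ : Set (ProbabilityMeasure (Database 𝒳 n k)))
    (ε : ℝ) (hε : 0 < ε) {d ℓ : ℕ} (hℓ : 0 < ℓ) (hℓd : ℓ ≤ d)
    (f : Database 𝒳 n k → EuclideanSpace ℝ (Fin d)) (hf : Measurable f)
    (hmom : ∀ P ∈ Θ, ∀ j ∈ activePublic E,
      HasCondSecondMoment (P : Measure _) f (w j))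
    (σ : ℝ) :
    (∀ A : Matrix (Fin d) (Fin ℓ) ℝ,
      (⨆ P ∈ Θ, ⨆ j ∈ activePublic E,
          (∫⁻ x, opENorm (condCovariance
            (P : Measure _) f (w j) (w j x)) ∂P)
            * (⨆ r : Fin ℓ, ‖column A r‖ₑ ^ 2)
            / ENNReal.ofReal (Real.exp (2 * ε / ℓ) - 1)) ≤ ENNReal.ofReal (σ ^ 2) →
      IsMIPP g w E Θ ε
        (projectedGaussianMechanism f hf (Measure.dirac A) σ)) ∧
    (∀ (ν : Measure (Matrix (Fin d) (Fin ℓ) ℝ)) [IsProbabilityMeasure ν],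
      (∀ r, ∫ A, ‖column A r‖ ^ 2 ∂ν = 1) →
      (∀ r, ∫ A, column A r ∂ν = 0) →
      (⨆ P ∈ Θ, ⨆ j ∈ activePublic E,
          (∫⁻ x, (opENorm (condCovariance
              (P : Measure _) f (w j) (w j x))
            + ‖condMean
              (P : Measure _) f (w j) (w j x)‖ₑ ^ 2) ∂P)
            / ENNReal.ofReal (Real.exp (2 * ε / ℓ) - 1)) ≤ ENNReal.ofReal (σ ^ 2) →
      IsMIPP g w E Θ ε
        (projectedGaussianMechanism f hf ν σ)) := by
  obtain ⟨hdet, hrand⟩ := mainTheorem7_general g hg w hw E Θ ε hε hℓ f hf hmom σ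
  exact ⟨hdet, fun ν _ hν _ => hrand ν fun r => by
    simp [lintegral_enorm_sq_eq_ofReal_integral (.of_integral_ne_zero (hν r ▸ one_ne_zero)), hν r]⟩
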